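/- **Definitions.** An MV-algebra is $(A,\oplus,\neg,0)$ with $(A,\oplus,0)$ a commutative monoid, $\neg\neg x=x$, $x\oplus\neg 0=\neg 0$ and $\neg(\neg x\oplus y)\oplus y=\neg(\neg y\oplus x)\oplus x$. Put $u=\neg 0$, $x\odot y=\neg(\neg x\oplus\neg y)$, $x\ominus y=x\odot\neg y$, $x\wedge y=x\odot(\neg x\oplus y)$, and let $x\le y$ mean $x\ominus y=0$. A $PMV_f$-algebra is an MV-algebra with a commutative associative product such that $a0=0$, $a(b\oplus c)\le ab\oplus ac$, $ab\ominus ac\le a(b\ominus c)$, $ab\le a\wedge b$ and $a(b\ominus c)=ab\ominus ac$; it is a $PMV_f$-chain if $\le$ is total. Homomorphisms preserve $0,\oplus,\neg,\cdot$. An $l_u$-ring $(R,u)$ is a commutative ring (not necessarily with identity) with a lattice order such that addition is order preserving, products of nonnegative elements are nonnegative, and $u\ge 0$ is a strong unit (for every $x$ there is $n\in\mathbb N$ with $|x|\le nu$). It is semi-low if $ab\le a\wedge b$ for all $a,b\in[0,u]$, and a chain if its order is total. Homomorphisms are ring homomorphisms preserving $\vee,\wedge$ and the strong unit. For a $PMV_f$-chain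 $A$, let $A^\sharp$ be $\mathbb Z\times A$ with $(m+1,0)$ identified with $(m,u)$ for all $m\in\mathbb Z$, with zero $(0,0)$, $-(m,a)=(-m-1,\neg a)$, $$(m,a)+(n,b)=\begin{cases}(m+n,\,a\oplus b)&\text{if } a\oplus b\ne u,\\(m+n+1,\,a\odot b)&\text{if }a\oplus b=u,\end{cases}$$ $$(m,a)(n,b)=mn(0,u^2)+m(0,bu)+n(0,au)+(0,ab),$$ the order induced by the lexicographic order on pairs (two classes are comparable if some representatives are), and strong unit $(0,u)=(1,0)$. This is a chain semi-low $l_u$-ring, and $A\mapsto A^\sharp$, $h\mapsto h^\sharp$ with $h^\sharp(m,a)=(m,h(a))$, is a functor. For a chain semi-low $l_u$-ring $(R,u)$, let $\Gamma(R,u)=\{x\in R: 0\le x\le u\}$ with $x\oplus y=(x+y)\wedge u$, $\neg x=u-x$ and the product of $R$. This is a $PMV_f$-chain, and $\Gamma$ is a functor when it acts on homomorphisms by restriction. **Theorem.** For every $PMV_f$-chain $A$ and every chain semi-low $l_u$-ring $(R,u)$ the maps $$i_A\colon A\to\Gamma(A^\sharp,(0,u)),\quad a\mapsto(0,a),\qquad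 \upsilon_R\colon \Gamma(R,u)^\sharp\to R,\quad (m,x)\mapsto mu+x,$$ are isomorphisms of $PMV_f$-algebras and of $l_u$-rings respectively. They are natural in $A$ and in $R$, and the functors $(-)^\sharp$ and $\Gamma$ are equivalences, quasi-inverse to each other via $i$ and $\upsilon$, between the category of $PMV_f$-chains and the category of chain semi-low $l_u$-rings. -/

import Mathlib

open CategoryTheory

universe v

set_option linter.unusedSectionVars false

/-! ## MV-algebras -/

/-- An MV-algebra `(A, ⊕, ¬, 0)`.  The sum `⊕` is written `+` and the negation `¬ x` is
written `xᶜ`. -/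
class MVAlgebra (A : Type v) extends AddCommMonoid A, Compl A where
  neg_neg : ∀ x : A, xᶜᶜ = x
  add_neg_zero : ∀ x : A, x + (0 : A)ᶜ = (0 : A)ᶜ
  lukasiewicz : ∀ x y : A, (xᶜ + y)ᶜ + y = (yᶜ + x)ᶜ + x

namespace MVAlgebra

variable {A : Type v} [MVAlgebra A]

/-- The largest element `u = ¬ 0`. -/
def top (A : Type v) [MVAlgebra A] : A := (0 : A)ᶜ

/-- `x ⊙ y = ¬ (¬ x ⊕ ¬ y)`. -/
def odot (x y : A) : A := (xᶜ + yᶜ)ᶜ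

/-- `x ⊖ y = x ⊙ ¬ y = ¬ (¬ x ⊕ y)`. -/
def ominus (x y : A) : A := (xᶜ + y)ᶜ

/-- The natural order of an MV-algebra: `x ≤ y` if and only if `x ⊖ y = 0`. -/
instance instLE : LE A := ⟨fun x y => ominus x y = 0⟩

/-- The infimum for the natural order, `x ∧ y = x ⊙ (¬ x ⊕ y)`. -/
def inf (x y : A) : A := odot x (xᶜ + y)

theorem le_def {x y : A} : x ≤ y ↔ ominus x y = 0 := Iff.rfl

@[simp] theorem compl2 (x : A) : xᶜᶜ = x := neg_neg x
@[simp] theorem add_topElt (x : A) : x + top A = top A := add_neg_zero x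
@[simp] theorem topElt_add (x : A) : top A + x = top A := by rw [add_comm, add_topElt]
@[simp] theorem compl_zeroElt : (0 : A)ᶜ = top A := rfl
@[simp] theorem compl_topElt : (top A)ᶜ = 0 := neg_neg 0

theorem compl_inj {x y : A} (h : xᶜ = yᶜ) : x = y := by rw [← compl2 x, h, compl2]

@[simp] theorem add_compl (x : A) : x + xᶜ = top A := by
  have h := lukasiewicz x (top A)
  simp only [add_topElt, compl_topElt, zero_add] at h
  rw [add_comm]; exact h.symm

@[simp] theorem compl_add (x : A) : xᶜ + x = top A := by rw [add_comm, add_compl]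

theorem odot_comm (x y : A) : odot x y = odot y x := by simp [odot, add_comm]
@[simp] theorem odot_compl (x : A) : odot x xᶜ = 0 := by simp [odot]
@[simp] theorem compl_odot_self (x : A) : odot xᶜ x = 0 := by simp [odot]
@[simp] theorem odot_top (x : A) : odot x (top A) = x := by simp [odot]
@[simp] theorem top_odot (x : A) : odot (top A) x = x := by simp [odot]
@[simp] theorem odot_zero (x : A) : odot x 0 = 0 := by simp [odot]
@[simp] theorem zero_odot (x : A) : odot 0 x = 0 := by simp [odot]

theorem le_iff_compl_add {x y : A} : x ≤ y ↔ xᶜ + y = top A := by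
  rw [le_def, ominus]
  constructor
  · intro h; apply compl_inj; simpa using h
  · intro h; rw [h]; simp

theorem odot_eq_zero_iff {x y : A} : odot x y = 0 ↔ x ≤ yᶜ := by
  rw [le_def, odot, ominus]

theorem add_eq_top_iff {x y : A} : x + y = top A ↔ xᶜ ≤ y := by
  rw [le_iff_compl_add, compl2]

/-- `(x ⊖ y) ⊕ y` is symmetric (it is the supremum). -/
theorem ominus_add_comm (x y : A) : ominus x y + y = ominus y x + x := lukasiewicz x y

theorem ominus_add_of_le {x y : A} (h : y ≤ x) : ominus x y + y = x := by
  rw [ominus_add_comm, le_def.1 h, zero_add]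

theorem le_rfl' (x : A) : x ≤ x := by rw [le_iff_compl_add]; simp

theorem le_antisymm' {x y : A} (h : x ≤ y) (h' : y ≤ x) : x = y := by
  have := ominus_add_of_le h
  rw [le_def.1 h', zero_add] at this
  exact this

theorem le_add (x y : A) : x ≤ x + y := by
  rw [le_iff_compl_add, ← add_assoc]; simp

theorem le_trans' {x y z : A} (h : x ≤ y) (h' : y ≤ z) : x ≤ z := by
  have h1 := ominus_add_of_le h
  have h2 := ominus_add_of_le h'
  rw [← h2, ← h1, ← add_assoc, add_comm]
  exact le_add _ _

theorem compl_le {x y : A} (h : x ≤ y) : yᶜ ≤ xᶜ := by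
  rw [le_iff_compl_add] at *
  rw [compl2, add_comm]; exact h

theorem zero_le' (x : A) : 0 ≤ x := by rw [le_iff_compl_add]; simp
theorem le_top' (x : A) : x ≤ top A := by rw [le_iff_compl_add]; simp

theorem eq_top_of_le {x : A} (h : top A ≤ x) : x = top A := le_antisymm' (le_top' x) h

theorem eq_zero_of_le {x : A} (h : x ≤ 0) : x = 0 := le_antisymm' h (zero_le' x)

theorem inf_le_left' (x y : A) : inf x y ≤ x := by
  rw [le_iff_compl_add, inf, odot, compl2, add_right_comm, compl_add, topElt_add]

theorem inf_comm' (x y : A) : inf x y = inf y x := by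
  have h := lukasiewicz xᶜ yᶜ
  simp only [compl2] at h
  simp only [inf, odot]
  rw [add_comm xᶜ (xᶜ + y)ᶜ, add_comm yᶜ (yᶜ + x)ᶜ, add_comm xᶜ y, add_comm yᶜ x, h]

theorem inf_le_right' (x y : A) : inf x y ≤ y := by
  rw [inf_comm']; exact inf_le_left' y x

theorem add_ominus_of_le {x y : A} (h : x ≤ yᶜ) : ominus (x + y) y = x := by
  have h1 := inf_comm' x yᶜ
  have h2 : inf x yᶜ = x := by
    have h3 : ominus x yᶜ = 0 := h
    simp only [ominus] at h3
    rw [inf, odot, h3, add_zero, compl2]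
  rw [h2] at h1
  simp only [inf, odot, compl2] at h1
  conv_rhs => rw [h1]
  rw [ominus, add_comm x y, add_comm y (y + x)ᶜ]

theorem ominus_add (x y z : A) : ominus x (y + z) = ominus (ominus x y) z := by
  simp [ominus, add_assoc]

theorem odot_assoc (x y z : A) : odot (odot x y) z = odot x (odot y z) := by
  simp [odot, add_assoc]

theorem carry₁ {a b c : A} (h : a ≤ bᶜ) (h' : b ≤ cᶜ) : odot (a + b) c = odot a (b + c) := by
  have e : odot (a + b) c = ominus (a + b) cᶜ := rfl
  have h1 := ominus_add_of_le h'
  rw [e, ← h1, add_comm (ominus cᶜ b) b, ominus_add, add_ominus_of_le h]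
  simp [ominus, odot, add_comm]

theorem carry₂ {a b c : A} (h : a ≤ bᶜ) (h' : b + c = top A) :
    odot (a + b) c = a + odot b c := by
  have h2 : cᶜ ≤ b := by rw [← add_eq_top_iff, add_comm, h']
  have e : odot (a + b) c = ominus (a + b) cᶜ := rfl
  have e' : ominus b cᶜ = odot b c := rfl
  have h1 := ominus_add_of_le h2
  rw [e]
  conv_lhs => rw [← h1]
  rw [← add_assoc, add_ominus_of_le, e']
  rw [compl2]
  have h3 : bᶜ ≤ c := by rwa [← add_eq_top_iff]
  have h4 := ominus_add_of_le h3
  have h5 := le_iff_compl_add.1 h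
  have e2 : ominus c bᶜ = odot b c := odot_comm c b
  have h7 : (a + odot b c)ᶜ + odot b c + bᶜ = top A := by
    have := ominus_add_comm (odot b c) aᶜ
    have h8 : (a + odot b c)ᶜ + odot b c = ominus aᶜ (odot b c) + odot b c := by
      simp [ominus]
    rw [h8, ← this, add_assoc, h5, add_topElt]
  rw [e2] at h4
  rw [le_iff_compl_add, e']
  rw [add_assoc, h4] at h7
  exact h7

theorem carry₃ {a b c : A} (h : a + b = top A) (h' : b + c = top A) :
    odot a b + c = a + odot b c := by
  have h1 : aᶜ ≤ bᶜᶜ := by rw [compl2]; exact add_eq_top_iff.1 h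
  have h2 : bᶜ ≤ cᶜᶜ := by rw [compl2]; exact add_eq_top_iff.1 h'
  have := carry₁ h1 h2
  simp only [odot, compl2] at this
  exact compl_inj this

end MVAlgebra

/-- A totally ordered MV-algebra. -/
class IsMVChain (A : Type v) [MVAlgebra A] : Prop where
  total : ∀ x y : A, x ≤ y ∨ y ≤ x

/-! ## `PMV_f`-algebras -/

/-- A (commutative) MVW-rig. -/
class MVWRig (A : Type v) extends MVAlgebra A, CommSemigroup A where
  mul_zero' : ∀ a : A, a * 0 = 0
  mul_add_ominus : ∀ a b c : A, MVAlgebra.ominus (a * (b + c)) (a * b + a * c) = 0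
  ominus_mul_ominus : ∀ a b c : A,
    MVAlgebra.ominus (MVAlgebra.ominus (a * b) (a * c)) (a * MVAlgebra.ominus b c) = 0

/-- A `PMV_f`-algebra. -/
class PMVf (A : Type v) extends MVWRig A where
  mul_le_inf : ∀ a b : A, a * b ≤ MVAlgebra.inf a b
  mul_ominus : ∀ a b c : A,
    a * MVAlgebra.ominus b c = MVAlgebra.ominus (a * b) (a * c)

namespace PMVf

open MVAlgebra

variable {A : Type v} [PMVf A]

theorem mul_zero (a : A) : a * 0 = 0 := MVWRig.mul_zero' a
theorem zero_mul (a : A) : 0 * a = 0 := by rw [mul_comm, mul_zero]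
theorem mul_le_left (a b : A) : a * b ≤ a := le_trans' (mul_le_inf a b) (inf_le_left' a b)
theorem mul_le_right (a b : A) : a * b ≤ b := le_trans' (mul_le_inf a b) (inf_le_right' a b)

theorem mul_mono (x : A) {a b : A} (h : a ≤ b) : x * a ≤ x * b := by
  rw [le_def, ← mul_ominus, le_def.1 h, mul_zero]

theorem mul_disjoint (x : A) {a b : A} (h : a ≤ bᶜ) : x * a ≤ (x * b)ᶜ :=
  le_trans' (mul_le_right x a) (le_trans' h (compl_le (mul_le_right x b)))

theorem mul_add_of_disjoint (x : A) {a b : A} (h : a ≤ bᶜ) :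
    x * (a + b) = x * a + x * b := by
  have hb : b ≤ a + b := by rw [add_comm]; exact le_add b a
  rw [← ominus_add_of_le (mul_mono x hb), ← mul_ominus, add_ominus_of_le h]

end PMVf

/-- Homomorphisms of `PMV_f`-algebras. -/
@[ext]
structure PMVfHom (A B : Type v) [PMVf A] [PMVf B] where
  toFun : A → B
  map_zero' : toFun 0 = 0
  map_add' : ∀ x y, toFun (x + y) = toFun x + toFun y
  map_compl' : ∀ x, toFun xᶜ = (toFun x)ᶜ
  map_mul' : ∀ x y, toFun (x * y) = toFun x * toFun y

/-! ## Semi-low `l_u`-rings -/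

/-- A (commutative, not necessarily unital) `l_u`-ring with strong unit `su`. -/
class LuRing (R : Type v) extends NonUnitalCommRing R, Lattice R where
  add_le_add_left' : ∀ a b : R, a ≤ b → ∀ c : R, c + a ≤ c + b
  mul_nonneg' : ∀ a b : R, 0 ≤ a → 0 ≤ b → 0 ≤ a * b
  su : R
  su_nonneg : 0 ≤ su
  exists_abs_le : ∀ x : R, ∃ n : ℕ, x⁺ + x⁻ ≤ n • su

/-- `a b ≤ a ∧ b` for all `a, b` in the segment `[0, u]`. -/
class IsSemiLow (R : Type v) [LuRing R] : Prop where
  mul_le_inf : ∀ a b : R, 0 ≤ a → a ≤ LuRing.su → 0 ≤ b → b ≤ LuRing.su → a * b ≤ a ⊓ b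

/-- The order is total. -/
class IsLuChain (R : Type v) [LuRing R] : Prop where
  total : ∀ x y : R, x ≤ y ∨ y ≤ x

instance (R : Type v) [LuRing R] : IsOrderedAddMonoid R where
  add_le_add_left a b h c := by
    rw [add_comm a, add_comm b]; exact LuRing.add_le_add_left' a b h c

/-- Homomorphisms of `l_u`-rings: ring homomorphisms that preserve the lattice operations and the
strong unit. -/
@[ext]
structure LuRingHom (R S : Type v) [LuRing R] [LuRing S] where
  toFun : R → S
  map_add' : ∀ x y, toFun (x + y) = toFun x + toFun y
  map_mul' : ∀ x y, toFun (x * y) = toFun x * toFun y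
  map_sup' : ∀ x y, toFun (x ⊔ y) = toFun x ⊔ toFun y
  map_inf' : ∀ x y, toFun (x ⊓ y) = toFun x ⊓ toFun y
  map_su' : toFun LuRing.su = LuRing.su

instance (A B : Type v) [PMVf A] [PMVf B] : FunLike (PMVfHom A B) A B where
  coe := PMVfHom.toFun
  coe_injective _ _ h := PMVfHom.ext h

instance (R S : Type v) [LuRing R] [LuRing S] : FunLike (LuRingHom R S) R S where
  coe := LuRingHom.toFun
  coe_injective _ _ h := LuRingHom.ext h

/-! ## Chang's construction -/

/-- The identification `(m + 1, 0) = (m, u)` on `ℤ × A`. -/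
inductive ChangRel (A : Type v) [MVAlgebra A] : ℤ × A → ℤ × A → Prop
  | glue (m : ℤ) : ChangRel A (m + 1, 0) (m, MVAlgebra.top A)

/-- The underlying set of `A^♯`: pairs `(m, a) ∈ ℤ × A`, where `(m + 1, 0) = (m, u)`. -/
def Sharp (A : Type v) [MVAlgebra A] : Type v := Quot (ChangRel A)

namespace Sharp

open MVAlgebra

section Group

variable {A : Type v} [MVAlgebra A]

/-- The class of the pair `(m, a)` in `A^♯`. -/
def mk (m : ℤ) (a : A) : Sharp A := Quot.mk _ (m, a)

theorem mk_glue (m : ℤ) : mk (m + 1) (0 : A) = mk m (top A) := Quot.sound (ChangRel.glue m)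

theorem ind {p : Sharp A → Prop} (h : ∀ m a, p (mk m a)) (x : Sharp A) : p x :=
  Quot.ind (fun q => h q.1 q.2) x

open Classical in
/-- `(m, a) + (n, b) = (m + n, a ⊕ b)` if `a ⊕ b ≠ u`, and `(m + n + 1, a ⊙ b)` if
`a ⊕ b = u`, on pairs. -/
noncomputable def addPair (p q : ℤ × A) : Sharp A :=
  if p.2 + q.2 = top A then mk (p.1 + q.1 + 1) (odot p.2 q.2) else mk (p.1 + q.1) (p.2 + q.2)

theorem addPair_comm (p q : ℤ × A) : addPair p q = addPair q p := by
  rw [addPair, addPair, add_comm p.2 q.2, add_comm p.1 q.1, odot_comm p.2 q.2]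

theorem addPair_congr (p : ℤ × A) {q q' : ℤ × A} (h : ChangRel A q q') :
    addPair p q = addPair p q' := by
  obtain ⟨n⟩ := h
  simp only [addPair, add_topElt, if_true, odot_top, _root_.add_zero, odot_zero]
  split_ifs with h
  · rw [mk_glue, ← add_assoc]; rw [_root_.add_zero] at h; rw [h]
  · rw [add_assoc]

noncomputable instance : Add (Sharp A) :=
  ⟨Quot.lift₂ addPair (fun p _ _ h => addPair_congr p h)
    (fun p p' q h => by rw [addPair_comm p, addPair_comm p', addPair_congr q h])⟩

instance : Zero (Sharp A) := ⟨mk 0 0⟩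

/-- `-(m, a) = (-m - 1, ¬ a)`. -/
instance : Neg (Sharp A) :=
  ⟨Quot.lift (fun p => mk (-p.1 - 1) p.2ᶜ) (by
    rintro _ _ ⟨m⟩
    have := mk_glue (A := A) (-(m + 1) - 1)
    simp only [compl_zeroElt, compl_topElt, ← this]
    congr 1; ring)⟩

/-- The order of `A^♯`, induced by the lexicographic order on pairs. -/
instance : LE (Sharp A) :=
  ⟨fun x y => ∃ (m : ℤ) (a : A) (n : ℤ) (b : A),
    x = mk m a ∧ y = mk n b ∧ (m < n ∨ m = n ∧ a ≤ b)⟩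

theorem neg_mk (m : ℤ) (a : A) : -mk m a = mk (-m - 1) aᶜ := rfl

theorem zero_def : (0 : Sharp A) = mk 0 0 := rfl

theorem add_def (m n : ℤ) (a b : A) : mk m a + mk n b = addPair (m, a) (n, b) := rfl

theorem mk_add_top (m n : ℤ) {a b : A} (h : a + b = top A) :
    mk m a + mk n b = mk (m + n + 1) (odot a b) := by
  simp [add_def, addPair, h]

theorem mk_add_disj (m n : ℤ) {a b : A} (h : a ≤ bᶜ) :
    mk m a + mk n b = mk (m + n) (a + b) := by
  by_cases h' : a + b = top A
  · rw [mk_add_top m n h', odot_eq_zero_iff.2 h, mk_glue, h']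
  · simp [add_def, addPair, h']

theorem add_comm' (x y : Sharp A) : x + y = y + x := by
  induction x using ind
  induction y using ind
  rw [add_def, add_def, addPair_comm]

open Classical in
/-- The normal form of a pair, with second component different from `u`. -/
noncomputable def normalForm (p : ℤ × A) : ℤ × A :=
  if p.2 = top A then (p.1 + 1, 0) else p

theorem normalForm_eq (h : top A ≠ 0) {m n : ℤ} {a b : A} (e : mk m a = mk n b) :
    normalForm (m, a) = normalForm (n, b) := by
  have hw : ∀ p q : ℤ × A, ChangRel A p q → normalForm p = normalForm q := by
    rintro _ _ ⟨k⟩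
    simp [normalForm, h.symm]
  exact congrArg (Quot.lift normalForm hw) e

theorem eq_zero_of_mk (h : top A ≠ 0) {m : ℤ} {a : A} (hm : 0 ≤ m) (e : mk m a = 0) :
    m = 0 ∧ a = 0 := by
  have := normalForm_eq h (e.trans zero_def)
  simp only [normalForm, h.symm, if_false] at this
  split_ifs at this with h1
  · simp only [Prod.mk.injEq] at this; omega
  · simpa using this

theorem eq_zero_of_trivial (h : top A = 0) (x : Sharp A) : x = 0 := by
  have ha : ∀ a : A, a = 0 := fun a => eq_zero_of_le (h ▸ le_top' a)
  have step : ∀ m : ℤ, mk (m + 1) (0 : A) = mk m 0 := fun m => by rw [mk_glue, h]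
  induction x using ind with
  | h m a =>
    rw [ha a, zero_def]
    induction m using Int.induction_on with
    | zero => rfl
    | succ n ih => rw [step, ih]
    | pred n ih => rw [← ih, ← step]; congr 1; ring

section Chain

variable [IsMVChain A]

theorem disj_or_top (a b : A) : a ≤ bᶜ ∨ a + b = top A := by
  rcases IsMVChain.total a bᶜ with h | h
  · exact Or.inl h
  · right; rw [add_comm, add_eq_top_iff]; exact h

theorem add_assoc' (x y z : Sharp A) : x + y + z = x + (y + z) := by
  induction x using ind with | h m a =>
  induction y using ind with | h n b =>
  induction z using ind with | h k c =>
  rcases disj_or_top a b with h1 | h1 <;> rcases disj_or_top b c with h2 | h2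
  · rw [mk_add_disj m n h1, mk_add_disj n k h2]
    have e := carry₁ h1 h2
    rcases disj_or_top (a + b) c with h3 | h3
    · have h4 : a ≤ (b + c)ᶜ := by rw [← odot_eq_zero_iff, ← e, odot_eq_zero_iff]; exact h3
      rw [mk_add_disj _ _ h3, mk_add_disj _ _ h4, add_assoc, add_assoc]
    · have h4 : a + (b + c) = top A := by rw [← add_assoc]; exact h3
      rw [mk_add_top _ _ h3, mk_add_top _ _ h4, e]; congr 1; ring
  · rw [mk_add_disj m n h1, mk_add_top n k h2]
    have h3 : a + b + c = top A := by rw [add_assoc, h2, add_topElt]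
    have h4 : a ≤ (odot b c)ᶜ := by
      rw [← odot_eq_zero_iff, ← odot_assoc, odot_eq_zero_iff.2 h1, zero_odot]
    rw [mk_add_top _ _ h3, mk_add_disj _ _ h4, carry₂ h1 h2]; congr 1; ring
  · rw [mk_add_top m n h1, mk_add_disj n k h2]
    have h3 : a + (b + c) = top A := by rw [← add_assoc, h1, topElt_add]
    have h4 : odot a b ≤ cᶜ := by
      rw [← odot_eq_zero_iff, odot_assoc, odot_eq_zero_iff.2 h2, odot_zero]
    have h5 : c ≤ bᶜ := by rw [← odot_eq_zero_iff, odot_comm, odot_eq_zero_iff]; exact h2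
    have e := carry₂ h5 (by rw [add_comm]; exact h1 : b + a = top A)
    rw [mk_add_top _ _ h3, mk_add_disj _ _ h4, odot_comm a (b + c), add_comm b c, e,
      odot_comm a b, add_comm c]
    congr 1; ring
  · rw [mk_add_top m n h1, mk_add_top n k h2]
    have e := carry₃ h1 h2
    rcases disj_or_top (odot a b) c with h3 | h3
    · have h4 : a ≤ (odot b c)ᶜ := by
        rw [← odot_eq_zero_iff, ← odot_assoc, odot_eq_zero_iff]; exact h3
      rw [mk_add_disj _ _ h3, mk_add_disj _ _ h4, e]; congr 1; ring
    · have h4 : a + odot b c = top A := by rw [← e]; exact h3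
      rw [mk_add_top _ _ h3, mk_add_top _ _ h4, odot_assoc]; congr 1; ring

theorem zero_add' (x : Sharp A) : 0 + x = x := by
  induction x using ind with | h m a =>
  rw [zero_def, mk_add_disj _ _ (zero_le' _), zero_add, zero_add]

theorem neg_add' (x : Sharp A) : -x + x = 0 := by
  induction x using ind with | h m a =>
  rw [neg_mk, mk_add_top _ _ (compl_add a), zero_def, compl_odot_self]
  congr 1; ring

noncomputable instance instAddCommGroup : AddCommGroup (Sharp A) where
  add_assoc := add_assoc'
  zero_add := zero_add'
  add_zero x := by rw [add_comm', zero_add']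
  add_comm := add_comm'
  neg_add_cancel := neg_add'
  nsmul := nsmulRec
  zsmul := zsmulRec

theorem mk_top : mk 1 (0 : A) = mk 0 (top A) := mk_glue 0

theorem zsmul_top (m : ℤ) : m • mk 0 (top A) = mk m 0 := by
  have step : ∀ m : ℤ, mk (m + 1) (0 : A) = mk m 0 + mk 0 (top A) := fun m => by
    rw [← mk_top, mk_add_disj _ _ (zero_le' _), add_zero]
  induction m using Int.induction_on with
  | zero => rw [zero_smul, zero_def]
  | succ n ih => rw [add_smul, one_smul, ih, step]
  | pred n ih => rw [sub_smul, one_smul, ih, sub_eq_iff_eq_add, ← step]; congr 1; ring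

theorem mk_eq (m : ℤ) (a : A) : mk m a = m • mk 0 (top A) + mk 0 a := by
  rw [zsmul_top, mk_add_disj _ _ (zero_le' _), add_zero, zero_add]

theorem le_iff {x y : Sharp A} : x ≤ y ↔ ∃ (k : ℤ) (c : A), 0 ≤ k ∧ y = x + mk k c := by
  constructor
  · rintro ⟨m, a, n, b, rfl, rfl, h⟩
    have key : mk n b = mk m a + (mk n b + -mk m a) := by abel
    rw [neg_mk] at key
    rcases h with h | ⟨rfl, h⟩
    · rcases disj_or_top b aᶜ with h' | h'
      · rw [mk_add_disj _ _ h'] at key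
        exact ⟨_, _, by omega, key⟩
      · rw [mk_add_top _ _ h'] at key
        exact ⟨_, _, by omega, key⟩
    · rw [mk_add_top _ _ (by rw [add_comm]; exact le_iff_compl_add.1 h)] at key
      exact ⟨_, _, by omega, key⟩
  · rintro ⟨k, c, hk, rfl⟩
    induction x using ind with | h m a =>
    rcases disj_or_top a c with h' | h'
    · refine ⟨m, a, _, _, rfl, mk_add_disj _ _ h', ?_⟩
      rcases hk.lt_or_eq with hk | rfl
      · left; omega
      · exact Or.inr ⟨by ring, le_add a c⟩
    · exact ⟨m, a, _, _, rfl, mk_add_top _ _ h', Or.inl (by omega)⟩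

theorem cone_add {k l : ℤ} (hk : 0 ≤ k) (hl : 0 ≤ l) (c d : A) :
    ∃ (j : ℤ) (e : A), 0 ≤ j ∧ mk k c + mk l d = mk j e := by
  rcases disj_or_top c d with h | h
  · exact ⟨_, _, by omega, mk_add_disj _ _ h⟩
  · exact ⟨_, _, by omega, mk_add_top _ _ h⟩

theorem cone_antisymm {k l : ℤ} (hk : 0 ≤ k) (hl : 0 ≤ l) {c d : A}
    (h : mk k c + mk l d = 0) : mk k c = 0 := by
  by_cases ht : top A = 0
  · exact eq_zero_of_trivial ht _
  · rcases disj_or_top c d with h' | h'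
    · rw [mk_add_disj _ _ h'] at h
      obtain ⟨h1, h2⟩ := eq_zero_of_mk ht (by omega) h
      have hc : c = 0 := eq_zero_of_le (h2 ▸ le_add c d)
      have : k = 0 := by omega
      rw [hc, this, zero_def]
    · rw [mk_add_top _ _ h'] at h
      have := (eq_zero_of_mk ht (by omega) h).1
      omega

theorem le_total' (x y : Sharp A) : x ≤ y ∨ y ≤ x := by
  induction x using ind with | h m a =>
  induction y using ind with | h n b =>
  rcases lt_trichotomy m n with h | rfl | h
  · exact Or.inl ⟨m, a, n, b, rfl, rfl, Or.inl h⟩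
  · rcases IsMVChain.total a b with h | h
    · exact Or.inl ⟨m, a, m, b, rfl, rfl, Or.inr ⟨rfl, h⟩⟩
    · exact Or.inr ⟨m, b, m, a, rfl, rfl, Or.inr ⟨rfl, h⟩⟩
  · exact Or.inr ⟨n, b, m, a, rfl, rfl, Or.inl h⟩

open Classical in
noncomputable instance instLinearOrder : LinearOrder (Sharp A) where
  le := (· ≤ ·)
  le_refl x := le_iff.2 ⟨0, 0, le_rfl, by rw [← zero_def, add_zero]⟩
  le_trans x y z h h' := by
    obtain ⟨k, c, hk, rfl⟩ := le_iff.1 h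
    obtain ⟨l, d, hl, rfl⟩ := le_iff.1 h'
    obtain ⟨j, e, hj, he⟩ := cone_add hk hl c d
    exact le_iff.2 ⟨j, e, hj, by rw [add_assoc, he]⟩
  le_antisymm x y h h' := by
    obtain ⟨k, c, hk, rfl⟩ := le_iff.1 h
    obtain ⟨l, d, hl, e⟩ := le_iff.1 h'
    have : mk k c + mk l d = 0 := by
      rw [add_assoc] at e
      exact (left_eq_add.1 e)
    rw [cone_antisymm hk hl this, add_zero]
  le_total := le_total'
  toDecidableLE := Classical.decRel _

theorem add_le_add' {x y : Sharp A} (h : x ≤ y) (z : Sharp A) : z + x ≤ z + y := by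
  obtain ⟨k, c, hk, rfl⟩ := le_iff.1 h
  exact le_iff.2 ⟨k, c, hk, by rw [add_assoc]⟩

instance : IsOrderedAddMonoid (Sharp A) where
  add_le_add_left a b h c := by
    rw [add_comm a, add_comm b]; exact add_le_add' h c

theorem mk_zero_le {a b : A} (h : a ≤ b) : mk 0 a ≤ mk 0 b :=
  ⟨0, a, 0, b, rfl, rfl, Or.inr ⟨rfl, h⟩⟩

theorem mk_nonneg (a : A) : 0 ≤ mk 0 a := mk_zero_le (zero_le' a)

theorem nonneg_iff {x : Sharp A} : 0 ≤ x ↔ ∃ (k : ℤ) (c : A), 0 ≤ k ∧ x = mk k c := by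
  rw [le_iff]; simp only [zero_add]

theorem mem_segment {x : Sharp A} (h : 0 ≤ x) (h' : x ≤ mk 0 (top A)) : ∃ a : A, x = mk 0 a := by
  obtain ⟨k, c, hk, rfl⟩ := nonneg_iff.1 h
  rcases hk.lt_or_eq with hk | rfl
  · refine ⟨top A, le_antisymm h' ?_⟩
    rw [← mk_top, mk_eq k, mk_eq 1, ← zero_def, add_zero]
    have h1 : (1 : ℤ) • mk 0 (top A) ≤ k • mk 0 (top A) :=
      zsmul_le_zsmul_left (mk_nonneg _) (by omega)
    exact h1.trans (le_add_of_nonneg_right (mk_nonneg c))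
  · exact ⟨c, rfl⟩

/-- A map that is additive on disjoint elements extends to a group homomorphism. -/
def lift {G : Type*} [AddCommGroup G] (f : A → G)
    (hf : ∀ a b : A, a ≤ bᶜ → f (a + b) = f a + f b) : Sharp A →+ G where
  toFun := Quot.lift (fun p => p.1 • f (top A) + f p.2) (by
    rintro _ _ ⟨m⟩
    have h0 : f 0 = 0 := by
      have := hf 0 0 (zero_le' _)
      rw [add_zero] at this
      exact left_eq_add.1 this
    simp only [h0, add_smul, one_smul, add_zero])
  map_zero' := by
    have h0 : f 0 = 0 := by
      have := hf 0 0 (zero_le' _)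
      rw [add_zero] at this
      exact left_eq_add.1 this
    change (0 : ℤ) • f (top A) + f 0 = 0
    rw [h0, zero_smul, add_zero]
  map_add' x y := by
    induction x using ind with | h m a =>
    induction y using ind with | h n b =>
    rcases disj_or_top a b with h | h
    · rw [mk_add_disj _ _ h]
      change (m + n) • f (top A) + f (a + b) =
        (m • f (top A) + f a) + (n • f (top A) + f b)
      rw [hf a b h, add_smul]; abel
    · rw [mk_add_top _ _ h]
      change (m + n + 1) • f (top A) + f (odot a b) =
        (m • f (top A) + f a) + (n • f (top A) + f b)
      have hba : bᶜ ≤ a := by rw [← add_eq_top_iff, add_comm]; exact h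
      have e1 : odot a b + bᶜ = a := ominus_add_of_le hba
      have d1 : odot a b ≤ bᶜᶜ := by
        rw [← odot_eq_zero_iff, odot_assoc, odot_compl, odot_zero]
      have e2 : f a = f (odot a b) + f bᶜ := by rw [← hf _ _ d1, e1]
      have e3 : f (top A) = f b + f bᶜ := by
        rw [← hf b bᶜ (by rw [compl2]; exact le_rfl' b), add_compl]
      rw [e2, add_smul, add_smul, one_smul]
      nth_rewrite 3 [e3]
      abel

theorem lift_mk {G : Type*} [AddCommGroup G] (f : A → G)
    (hf : ∀ a b : A, a ≤ bᶜ → f (a + b) = f a + f b) (m : ℤ) (a : A) :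
    lift f hf (mk m a) = m • f (top A) + f a := rfl

theorem lift_mk_zero {G : Type*} [AddCommGroup G] (f : A → G)
    (hf : ∀ a b : A, a ≤ bᶜ → f (a + b) = f a + f b) (a : A) :
    lift f hf (mk 0 a) = f a := by rw [lift_mk, zero_smul, zero_add]

theorem hom_ext {G : Type*} [AddCommGroup G] {f g : Sharp A →+ G}
    (h : ∀ a : A, f (mk 0 a) = g (mk 0 a)) : f = g := by
  ext x
  induction x using ind with | h m a =>
  rw [mk_eq, map_add, map_add, map_zsmul, map_zsmul, h, h]

end Chain

end Group

section Ring

variable {A : Type v} [PMVf A] [IsMVChain A]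

/-- `(m, a) (n, b) = mn (0, u²) + m (0, bu) + n (0, au) + (0, ab)`, on pairs. -/
noncomputable def mulPair (p q : ℤ × A) : Sharp A :=
  (p.1 * q.1) • mk 0 (top A * top A) + p.1 • mk 0 (q.2 * top A) + q.1 • mk 0 (p.2 * top A)
    + mk 0 (p.2 * q.2)

theorem mulPair_comm (p q : ℤ × A) : mulPair p q = mulPair q p := by
  simp only [mulPair, mul_comm p.1, mul_comm p.2 q.2]; abel

theorem mulPair_congr (p : ℤ × A) {q q' : ℤ × A} (h : ChangRel A q q') :
    mulPair p q = mulPair p q' := by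
  obtain ⟨n⟩ := h
  simp only [mulPair, PMVf.mul_zero, PMVf.zero_mul, ← zero_def, mul_add, add_smul, mul_one,
    one_smul, smul_zero]
  abel

noncomputable instance : Mul (Sharp A) :=
  ⟨Quot.lift₂ mulPair (fun p _ _ h => mulPair_congr p h)
    (fun p p' q h => by rw [mulPair_comm p, mulPair_comm p', mulPair_congr q h])⟩

theorem mul_def (m n : ℤ) (a b : A) : mk m a * mk n b =
    (m * n) • mk 0 (top A * top A) + m • mk 0 (b * top A) + n • mk 0 (a * top A)
      + mk 0 (a * b) := rfl

theorem mk_mul_mk (a b : A) : mk 0 a * mk 0 b = mk 0 (a * b) := by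
  simp [mul_def]

theorem mk_add_mk_disj {a b : A} (h : a ≤ bᶜ) : mk 0 (a + b) = mk 0 a + mk 0 b := by
  rw [mk_add_disj _ _ h, add_zero]

/-- Multiplication as a biadditive map. -/
noncomputable def mulHom : Sharp A →+ Sharp A →+ Sharp A :=
  lift (fun a => lift (fun b => mk 0 (a * b)) (fun b c h => by
      rw [PMVf.mul_add_of_disjoint a h, mk_add_mk_disj (PMVf.mul_disjoint a h)]))
    (fun a b h => hom_ext (fun c => by
      rw [AddMonoidHom.add_apply, lift_mk_zero, lift_mk_zero, lift_mk_zero, mul_comm,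
        PMVf.mul_add_of_disjoint c h, mk_add_mk_disj (PMVf.mul_disjoint c h), mul_comm c a,
        mul_comm c b]))

theorem mul_eq_mulHom (x y : Sharp A) : x * y = mulHom x y := by
  induction x using ind with | h m a =>
  induction y using ind with | h n b =>
  rw [mul_def, mulHom, lift_mk, AddMonoidHom.add_apply, AddMonoidHom.smul_apply, lift_mk, lift_mk,
    smul_add, smul_smul, mul_comm b (top A)]
  abel

noncomputable instance : NonUnitalCommRing (Sharp A) :=
  { instAddCommGroup (A := A) with
    mul := (· * ·)
    left_distrib := fun x y z => by simp only [mul_eq_mulHom, map_add]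
    right_distrib := fun x y z => by simp only [mul_eq_mulHom, map_add, AddMonoidHom.add_apply]
    zero_mul := fun x => by simp only [mul_eq_mulHom, map_zero, AddMonoidHom.zero_apply]
    mul_zero := fun x => by simp only [mul_eq_mulHom, map_zero]
    mul_comm := fun x y => by
      induction x using ind
      induction y using ind
      exact mulPair_comm _ _
    mul_assoc := fun x y z => by
      have key : ∀ a b c : A,
          mulHom (mulHom (mk 0 a) (mk 0 b)) (mk 0 c) = mulHom (mk 0 a) (mulHom (mk 0 b) (mk 0 c)) := by
        intro a b c
        simp only [← mul_eq_mulHom, mk_mul_mk, mul_assoc]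
      induction x using ind with | h m a =>
      induction y using ind with | h n b =>
      induction z using ind with | h k c =>
      rw [mk_eq m, mk_eq n, mk_eq k]
      simp only [mul_eq_mulHom, map_add, map_zsmul, AddMonoidHom.add_apply,
        AddMonoidHom.smul_apply, smul_add, key] }

theorem mul_nonneg' {x y : Sharp A} (hx : 0 ≤ x) (hy : 0 ≤ y) : 0 ≤ x * y := by
  obtain ⟨k, c, hk, rfl⟩ := nonneg_iff.1 hx
  obtain ⟨l, d, hl, rfl⟩ := nonneg_iff.1 hy
  rw [mul_def]
  exact add_nonneg (add_nonneg (add_nonneg (zsmul_nonneg (mk_nonneg _) (by positivity))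
    (zsmul_nonneg (mk_nonneg _) hk)) (zsmul_nonneg (mk_nonneg _) hl)) (mk_nonneg _)

/-- `A^♯` is an `l_u`-ring with strong unit `(0, u)`. -/
noncomputable instance : LuRing (Sharp A) :=
  { (inferInstance : NonUnitalCommRing (Sharp A)), (inferInstance : Lattice (Sharp A)) with
    add_le_add_left' := fun _ _ h c => add_le_add' h c
    mul_nonneg' := fun _ _ h h' => mul_nonneg' h h'
    su := mk 0 (top A)
    su_nonneg := mk_nonneg _
    exists_abs_le := fun x => by
      induction x using ind with | h m a =>
      refine ⟨m.natAbs + 1, ?_⟩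
      rw [posPart_add_negPart, ← natCast_zsmul]
      have h0 : (0 : Sharp A) ≤ mk 0 (top A) := mk_nonneg _
      have h1 : mk 0 a ≤ mk 0 (top A) := mk_zero_le (le_top' a)
      have h2 : (0 : Sharp A) ≤ mk 0 a := mk_nonneg _
      rw [mk_eq]
      refine abs_le'.2 ⟨?_, ?_⟩
      · have h3 : m • mk 0 (top A) ≤ (m.natAbs : ℤ) • mk 0 (top A) :=
          zsmul_le_zsmul_left h0 (by omega)
        rw [Nat.cast_add, Nat.cast_one, add_smul, one_smul]
        exact add_le_add h3 h1
      · have h3 : (-m) • mk 0 (top A) ≤ ((m.natAbs + 1 : ℕ) : ℤ) • mk 0 (top A) :=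
          zsmul_le_zsmul_left h0 (by omega)
        rw [neg_add, ← neg_smul]
        exact (add_le_add h3 (neg_nonpos.2 h2)).trans (by rw [_root_.add_zero]) }

theorem su_def : (LuRing.su : Sharp A) = mk 0 (top A) := rfl

instance : IsLuChain (Sharp A) := ⟨le_total'⟩

instance : IsSemiLow (Sharp A) where
  mul_le_inf x y hx hx' hy hy' := by
    obtain ⟨a, rfl⟩ := mem_segment hx hx'
    obtain ⟨b, rfl⟩ := mem_segment hy hy'
    rw [mk_mul_mk]
    exact le_inf (mk_zero_le (PMVf.mul_le_left a b)) (mk_zero_le (PMVf.mul_le_right a b))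

end Ring

section Map

variable {A B : Type v} [PMVf A] [IsMVChain A] [PMVf B] [IsMVChain B]

/-- The map `(m, a) ↦ (m, h a)`. -/
def mapFun (h : PMVfHom A B) : Sharp A → Sharp B :=
  Quot.map (fun p => (p.1, h.toFun p.2)) (by
    rintro _ _ ⟨m⟩
    change ChangRel B (m + 1, h.toFun 0) (m, h.toFun (0 : A)ᶜ)
    rw [h.map_compl', h.map_zero']
    exact ChangRel.glue m)

theorem map_topElt (h : PMVfHom A B) : h.toFun (top A) = top B := by
  rw [top, h.map_compl', h.map_zero']; rfl

theorem map_mono (h : PMVfHom A B) {a b : A} (hab : a ≤ b) : h.toFun a ≤ h.toFun b := by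
  rw [le_iff_compl_add] at *
  rw [← h.map_compl', ← h.map_add', hab, map_topElt]

theorem mapFun_mk (h : PMVfHom A B) (m : ℤ) (a : A) : mapFun h (mk m a) = mk m (h.toFun a) := rfl

/-- `mapFun h` as a group homomorphism. -/
noncomputable def mapAdd (h : PMVfHom A B) : Sharp A →+ Sharp B :=
  lift (fun a => mk 0 (h.toFun a)) (fun a b hab => by
    rw [h.map_add', mk_add_mk_disj]
    rw [← h.map_compl']; exact map_mono h hab)

theorem mapFun_eq (h : PMVfHom A B) (x : Sharp A) : mapFun h x = mapAdd h x := by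
  induction x using ind with | h m a =>
  rw [mapFun_mk, mapAdd, lift_mk, map_topElt, ← mk_eq]

theorem mapFun_mono (h : PMVfHom A B) : Monotone (mapFun h) := by
  rintro _ _ ⟨m, a, n, b, rfl, rfl, hab⟩
  exact ⟨m, _, n, _, rfl, rfl, hab.imp id (And.imp id (map_mono h))⟩

/-- `h^♯ (m, a) = (m, h a)`, as a homomorphism of `l_u`-rings. -/
def map (h : PMVfHom A B) : LuRingHom (Sharp A) (Sharp B) where
  toFun := mapFun h
  map_add' x y := by rw [mapFun_eq, mapFun_eq, mapFun_eq, map_add]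
  map_mul' x y := by
    induction x using ind with | h m a =>
    induction y using ind with | h n b =>
    rw [mapFun_mk, mapFun_mk, mul_def, mul_def, mapFun_eq]
    simp only [map_add, map_zsmul, ← mapFun_eq, mapFun_mk, h.map_mul', map_topElt]
  map_sup' x y := (mapFun_mono h).map_sup x y
  map_inf' x y := (mapFun_mono h).map_inf x y
  map_su' := by rw [su_def, su_def, mapFun_mk, map_topElt]

end Map

end Sharp

/-! ## The segment `Γ(R, u)` -/

/-- `Γ(R, u) = {x ∈ R ∣ 0 ≤ x ≤ u}`. -/
def Gam (R : Type v) [LuRing R] : Type v := {x : R // 0 ≤ x ∧ x ≤ LuRing.su}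

namespace Gam

section

variable {R : Type v} [LuRing R]

/-- The inclusion of `Γ(R, u)` in `R`. -/
def val (x : Gam R) : R := Subtype.val x

theorem ext {x y : Gam R} (h : x.val = y.val) : x = y := Subtype.ext h
theorem nonneg (x : Gam R) : 0 ≤ x.val := x.2.1
theorem le_su (x : Gam R) : x.val ≤ LuRing.su := x.2.2

instance : Zero (Gam R) := ⟨⟨0, le_rfl, LuRing.su_nonneg⟩⟩

/-- `x ⊕ y = (x + y) ∧ u`. -/
instance : Add (Gam R) :=
  ⟨fun x y => ⟨(x.val + y.val) ⊓ LuRing.su,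
    le_inf (add_nonneg x.nonneg y.nonneg) LuRing.su_nonneg, inf_le_right⟩⟩

/-- `¬ x = u - x`. -/
instance : Compl (Gam R) :=
  ⟨fun x => ⟨LuRing.su - x.val, sub_nonneg.2 x.le_su, sub_le_self _ x.nonneg⟩⟩

theorem val_zero : (0 : Gam R).val = 0 := rfl
theorem val_add (x y : Gam R) : (x + y).val = (x.val + y.val) ⊓ LuRing.su := rfl
theorem val_compl (x : Gam R) : (xᶜ).val = LuRing.su - x.val := rfl

theorem add_assoc_aux {x y z u : R} (hx : 0 ≤ x) (hz : 0 ≤ z) :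
    ((x + y) ⊓ u + z) ⊓ u = (x + (y + z) ⊓ u) ⊓ u := by
  rw [inf_add, add_inf, inf_assoc, inf_assoc, inf_eq_right.2 (le_add_of_nonneg_right hz),
    inf_eq_right.2 (le_add_of_nonneg_left hx), add_assoc]

theorem ominus_aux (x y u : R) : u - ((u - x + y) ⊓ u) = (x - y) ⊔ 0 := by
  rw [sub_eq_add_neg, neg_inf, add_sup, add_neg_cancel]
  congr 1; abel

instance instMVAlgebra : MVAlgebra (Gam R) where
  add_assoc x y z := ext (add_assoc_aux x.nonneg z.nonneg)
  zero_add x := ext (by rw [val_add, val_zero, zero_add, inf_eq_left.2 x.le_su])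
  add_zero x := ext (by rw [val_add, val_zero, add_zero, inf_eq_left.2 x.le_su])
  add_comm x y := ext (by rw [val_add, val_add, add_comm])
  nsmul := nsmulRec
  neg_neg x := ext (by rw [val_compl, val_compl, sub_sub_cancel])
  add_neg_zero x := ext (by
    rw [val_add, val_compl, val_zero, sub_zero]
    exact inf_eq_right.2 (le_add_of_nonneg_left x.nonneg))
  lukasiewicz x y := ext (by
    rw [val_add, val_compl, val_add, val_compl, val_add, val_compl, val_add, val_compl,
      ominus_aux, ominus_aux, sup_add, sup_add, sub_add_cancel, sub_add_cancel, zero_add,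
      zero_add, sup_comm])

theorem val_ominus (x y : Gam R) : (MVAlgebra.ominus x y).val = (x.val - y.val) ⊔ 0 := by
  rw [MVAlgebra.ominus, val_compl, val_add, val_compl, ominus_aux]

theorem le_iff {x y : Gam R} : x ≤ y ↔ x.val ≤ y.val := by
  rw [MVAlgebra.le_def, ← sub_nonpos, ← sup_eq_right (a := x.val - y.val), ← val_ominus]
  exact ⟨fun h => by rw [h, val_zero], fun h => ext h⟩

theorem val_inf (x y : Gam R) : (MVAlgebra.inf x y).val = x.val ⊓ y.val := by
  have h : MVAlgebra.inf x y = MVAlgebra.ominus x (MVAlgebra.ominus x y) := by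
    rw [MVAlgebra.inf, MVAlgebra.odot, MVAlgebra.ominus, MVAlgebra.ominus]
  rw [h, val_ominus, val_ominus, sub_sup, sub_sub_cancel, sub_zero]
  rw [sup_eq_left.2 (le_inf y.nonneg x.nonneg), inf_comm]

instance [IsLuChain R] : IsMVChain (Gam R) where
  total x y := by rw [le_iff, le_iff]; exact IsLuChain.total _ _

theorem val_topElt : (MVAlgebra.top (Gam R)).val = LuRing.su := sub_zero _

end

section Mul

variable {R : Type v} [LuRing R] [IsSemiLow R]

/-- The product of `R`, restricted to `Γ(R, u)`. -/
instance : Mul (Gam R) :=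
  ⟨fun x y => ⟨x.val * y.val, LuRing.mul_nonneg' _ _ x.nonneg y.nonneg,
    (IsSemiLow.mul_le_inf _ _ x.nonneg x.le_su y.nonneg y.le_su).trans
      (inf_le_left.trans x.le_su)⟩⟩

theorem val_mul (x y : Gam R) : (x * y).val = x.val * y.val := rfl

theorem mul_le_mul' {a b c : R} (ha : 0 ≤ a) (h : b ≤ c) : a * b ≤ a * c := by
  have := LuRing.mul_nonneg' a (c - b) ha (sub_nonneg.2 h)
  rw [mul_sub] at this
  exact sub_nonneg.1 this

theorem mul_ominus' [IsLuChain R] (a b c : Gam R) :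
    a * MVAlgebra.ominus b c = MVAlgebra.ominus (a * b) (a * c) := ext (by
  rw [val_mul, val_ominus, val_ominus, val_mul, val_mul]
  rcases IsLuChain.total b.val c.val with h | h
  · rw [sup_eq_right.2 (sub_nonpos.2 h), mul_zero,
      sup_eq_right.2 (sub_nonpos.2 (mul_le_mul' a.nonneg h))]
  · rw [sup_eq_left.2 (sub_nonneg.2 h), mul_sub,
      sup_eq_left.2 (sub_nonneg.2 (mul_le_mul' a.nonneg h))])

instance instPMVf [IsLuChain R] : PMVf (Gam R) where
  mul_assoc x y z := ext (mul_assoc x.val y.val z.val)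
  mul_comm x y := ext (mul_comm x.val y.val)
  mul_zero' x := ext (mul_zero x.val)
  mul_add_ominus a b c := le_iff.2 (by
    rw [val_mul, val_add, val_add, val_mul, val_mul]
    refine le_inf ?_ ?_
    · rw [← mul_add]; exact mul_le_mul' a.nonneg inf_le_left
    · exact (a * (b + c)).le_su)
  ominus_mul_ominus a b c := by
    rw [mul_ominus']; exact MVAlgebra.le_rfl' _
  mul_le_inf a b := le_iff.2 (by
    rw [val_inf]; exact IsSemiLow.mul_le_inf _ _ a.nonneg a.le_su b.nonneg b.le_su)
  mul_ominus := mul_ominus'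

end Mul

section Map

variable {R S : Type v} [LuRing R] [IsSemiLow R] [IsLuChain R] [LuRing S] [IsSemiLow S]
  [IsLuChain S]

theorem map_zero (f : LuRingHom R S) : f.toFun 0 = 0 := by
  have := f.map_add' 0 0
  rw [add_zero] at this
  exact left_eq_add.1 this

theorem map_sub (f : LuRingHom R S) (x y : R) : f.toFun (x - y) = f.toFun x - f.toFun y := by
  rw [eq_sub_iff_add_eq, ← f.map_add', sub_add_cancel]

theorem map_mono (f : LuRingHom R S) {x y : R} (h : x ≤ y) : f.toFun x ≤ f.toFun y := by
  rw [← sup_eq_right, ← f.map_sup', sup_eq_right.2 h]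

/-- `Γ(f)` is the restriction of `f` to `[0, u]`. -/
def map (f : LuRingHom R S) : PMVfHom (Gam R) (Gam S) where
  toFun x := ⟨f.toFun x.val, by rw [← map_zero f]; exact map_mono f x.nonneg,
    by rw [← f.map_su']; exact map_mono f x.le_su⟩
  map_zero' := ext (map_zero f)
  map_add' x y := ext (by
    change f.toFun ((x.val + y.val) ⊓ LuRing.su) = (f.toFun x.val + f.toFun y.val) ⊓ LuRing.su
    rw [f.map_inf', f.map_add', f.map_su'])
  map_compl' x := ext (by
    change f.toFun (LuRing.su - x.val) = LuRing.su - f.toFun x.val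
    rw [map_sub, f.map_su'])
  map_mul' x y := ext (f.map_mul' x.val y.val)

end Map

end Gam

/-! ## The categories and the functors -/

/-- The category of `PMV_f`-chains. -/
structure CPMVf : Type (v + 1) where
  carrier : Type v
  [pmvf : PMVf carrier]
  [chain : IsMVChain carrier]

attribute [instance] CPMVf.pmvf CPMVf.chain

/-- The category of chain semi-low `l_u`-rings. -/
structure CLRu : Type (v + 1) where
  carrier : Type v
  [luRing : LuRing carrier]
  [semiLow : IsSemiLow carrier]
  [chain : IsLuChain carrier]

attribute [instance] CLRu.luRing CLRu.semiLow CLRu.chain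

namespace CPMVf

instance : CoeSort CPMVf.{v} (Type v) := ⟨carrier⟩

instance : Category CPMVf.{v} where
  Hom A B := PMVfHom A B
  id A := ⟨fun a => a, rfl, fun _ _ => rfl, fun _ => rfl, fun _ _ => rfl⟩
  comp f g := ⟨fun a => g.toFun (f.toFun a), by rw [f.map_zero', g.map_zero'],
    fun x y => by rw [f.map_add', g.map_add'], fun x => by rw [f.map_compl', g.map_compl'],
    fun x y => by rw [f.map_mul', g.map_mul']⟩

instance : ConcreteCategory CPMVf.{v} (fun A B => PMVfHom A B) where
  hom f := f
  ofHom f := f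

end CPMVf

namespace CLRu

instance : CoeSort CLRu.{v} (Type v) := ⟨carrier⟩

instance : Category CLRu.{v} where
  Hom R S := LuRingHom R S
  id R := ⟨fun a => a, fun _ _ => rfl, fun _ _ => rfl, fun _ _ => rfl, fun _ _ => rfl, rfl⟩
  comp f g := ⟨fun a => g.toFun (f.toFun a), fun x y => by rw [f.map_add', g.map_add'],
    fun x y => by rw [f.map_mul', g.map_mul'], fun x y => by rw [f.map_sup', g.map_sup'],
    fun x y => by rw [f.map_inf', g.map_inf'], by rw [f.map_su', g.map_su']⟩

instance : ConcreteCategory CLRu.{v} (fun R S => LuRingHom R S) where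
  hom f := f
  ofHom f := f

end CLRu

/-- The functor `(-)^♯` from `PMV_f`-chains to chain semi-low `l_u`-rings. -/
noncomputable def sharpFunctor : CPMVf.{v} ⥤ CLRu.{v} where
  obj A := ⟨Sharp A⟩
  map h := Sharp.map h
  map_id A := LuRingHom.ext (funext fun x => by
    induction x using Sharp.ind; rfl)
  map_comp f g := LuRingHom.ext (funext fun x => by
    induction x using Sharp.ind; rfl)

/-- The functor `Γ` from chain semi-low `l_u`-rings to `PMV_f`-chains. -/
def gammaFunctor : CLRu.{v} ⥤ CPMVf.{v} where
  obj R := ⟨Gam R⟩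
  map f := Gam.map f

/-! A chain semi-low `l_u`-ring is determined by its segment. Since `u` is a strong unit and the
order is total, every element is an integer multiple of `u` plus an element of [0, u], uniquely up
to (m + 1, 0) = (m, u). The construction `Sharp` is built from exactly these coordinates, so the
unit and the counit only read them off.

The unit respects ⊕ because truncation at `u` undoes the carry: the sum of (0, a) and (0, b) is (0,
a ⊕ b), or, when a ⊕ b = u, it is (1, a ⊙ b), which is at least `u` and is cut back to it. It is
injective by normal forms (`mk_zero_injective`) and reaches the whole segment by `mem_segment`.

The counit is additive because the inclusion of the segment in `R` is additive on disjoint elements,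
which is all that `Sharp.lift` requires. It maps nonnegative elements to nonnegative elements, hence
is monotone, hence preserves ∨ and ∧, its source being a chain. By totality its kernel need only be
tested on nonnegative elements (`ofSharpAdd_eq_zero_of_nonneg`), and its range is everything because
subtracting `u` finitely often brings a positive element into the segment (`mem_range_of_le_nsmul`).

Bijective homomorphisms are invertible in both categories, so the two natural transformations are
isomorphisms and give the equivalence. -/

/-! ### Bijective homomorphisms are isomorphisms. -/

namespace CPMVf

/-- A bijective homomorphism of `PMV_f`-algebras is an isomorphism. -/
theorem isIso_of_bijective {A B : CPMVf.{v}} (f : A ⟶ B)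
    (hf : Function.Bijective (PMVfHom.toFun f)) : IsIso f := by
  obtain ⟨g, hgf, hfg⟩ := Function.bijective_iff_has_inverse.1 hf
  -- Each law for `g` is checked after applying the injective map `f`, where it becomes the same law
  -- for `f`.
  let g' : PMVfHom B A :=
    { toFun := g
      map_zero' := hf.1 (by rw [hfg, PMVfHom.map_zero'])
      map_add' := fun x y => hf.1 (by rw [hfg, PMVfHom.map_add', hfg, hfg])
      map_compl' := fun x => hf.1 (by rw [hfg, PMVfHom.map_compl', hfg])
      map_mul' := fun x y => hf.1 (by rw [hfg, PMVfHom.map_mul', hfg, hfg]) }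
  exact ⟨g', PMVfHom.ext (funext hgf), PMVfHom.ext (funext hfg)⟩

end CPMVf

namespace CLRu

/-- A bijective homomorphism of `l_u`-rings is an isomorphism. -/
theorem isIso_of_bijective {R S : CLRu.{v}} (f : R ⟶ S)
    (hf : Function.Bijective (LuRingHom.toFun f)) : IsIso f := by
  obtain ⟨g, hgf, hfg⟩ := Function.bijective_iff_has_inverse.1 hf
  let g' : LuRingHom S R :=
    { toFun := g
      map_add' := fun x y => hf.1 (by rw [hfg, LuRingHom.map_add', hfg, hfg])
      map_mul' := fun x y => hf.1 (by rw [hfg, LuRingHom.map_mul', hfg, hfg])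
      map_sup' := fun x y => hf.1 (by rw [hfg, LuRingHom.map_sup', hfg, hfg])
      map_inf' := fun x y => hf.1 (by rw [hfg, LuRingHom.map_inf', hfg, hfg])
      map_su' := hf.1 (by rw [hfg, LuRingHom.map_su']) }
  exact ⟨g', LuRingHom.ext (funext hgf), LuRingHom.ext (funext hfg)⟩

end CLRu

/-! ### The unit: `A` is the segment of `A^♯`. -/

namespace Sharp

open MVAlgebra

/-- Normal forms are invariant under the gluing only if `u ≠ 0`, so the one-element algebra is
treated apart. Otherwise (0, a) is its own normal form unless a = u, when it becomes (1, 0); the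
first coordinates 0 and 1 keep the two cases apart. -/
theorem mk_zero_injective {A : Type v} [MVAlgebra A] :
    Function.Injective (mk 0 : A → Sharp A) := by
  intro a b h
  by_cases ht : top A = 0
  · have h0 : ∀ c : A, c = 0 := fun c => eq_zero_of_le (ht ▸ le_top' c)
    rw [h0 a, h0 b]
  · have e := normalForm_eq ht h
    simp only [normalForm] at e
    split_ifs at e with ha hb hb
    · rw [ha, hb]
    · simp at e
    · simp at e
    · exact (Prod.mk.inj e).2

variable {A : Type v} [PMVf A] [IsMVChain A]

/-- The unit `a ↦ (0, a)`, as a homomorphism of `PMV_f`-algebras. -/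
noncomputable def toGam (A : Type v) [PMVf A] [IsMVChain A] : PMVfHom A (Gam (Sharp A)) where
  toFun a := ⟨mk 0 a, mk_nonneg a, mk_zero_le (le_top' a)⟩
  map_zero' := rfl
  map_add' a b := Gam.ext (by
    change mk 0 (a + b) = (mk 0 a + mk 0 b) ⊓ mk 0 (top A)
    rcases disj_or_top a b with h | h
    -- No carry: the sum stays in the segment and the truncation does nothing.
    · rw [mk_add_mk_disj h, inf_eq_left.2]
      rw [← mk_add_mk_disj h]
      exact mk_zero_le (le_top' _)
    · rw [h, mk_add_top _ _ h, inf_eq_right.2]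
      -- With a carry the integer part is 0 + 0 + 1, so the sum dominates (0, u) lexicographically
      -- and the truncation returns `u`.
      exact ⟨0, _, _, _, rfl, rfl, Or.inl (by norm_num)⟩)
  map_compl' a := Gam.ext (by
    change mk 0 aᶜ = mk 0 (top A) - mk 0 a
    -- The elements ¬a and a are disjoint, so they add to (0, ¬a ⊕ a) = (0, u).
    rw [eq_sub_iff_add_eq, ← mk_add_mk_disj (le_rfl' _), compl_add])
  map_mul' a b := Gam.ext (mk_mul_mk a b).symm

theorem toGam_bijective : Function.Bijective (toGam A).toFun :=
  ⟨fun _ _ h => mk_zero_injective (congrArg Gam.val h), fun x => by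
    obtain ⟨a, ha⟩ := mem_segment x.nonneg x.le_su
    exact ⟨a, Gam.ext ha.symm⟩⟩

end Sharp

/-! ### The counit: `R` is rebuilt from its segment. -/

namespace Gam

open Sharp

section Counit

variable {R : Type v} [LuRing R] [IsSemiLow R] [IsLuChain R]

/-- Disjointness says that the sum in `R` stays below `u`, so nothing is truncated. This is the
hypothesis of `Sharp.lift`. -/
theorem val_add_of_disjoint {x y : Gam R} (h : x ≤ yᶜ) : (x + y).val = x.val + y.val := by
  rw [le_iff, val_compl, le_sub_iff_add_le] at h
  rw [val_add, inf_eq_left.2 h]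

/-- The counit `(m, x) ↦ m u + x`, as a homomorphism of groups. -/
noncomputable def ofSharpAdd (R : Type v) [LuRing R] [IsSemiLow R] [IsLuChain R] :
    Sharp (Gam R) →+ R :=
  Sharp.lift val fun _ _ => val_add_of_disjoint

theorem ofSharpAdd_mk (m : ℤ) (x : Gam R) :
    ofSharpAdd R (mk m x) = m • LuRing.su + x.val := by
  rw [ofSharpAdd, lift_mk, val_topElt]

theorem ofSharpAdd_mk_zero (x : Gam R) : ofSharpAdd R (mk 0 x) = x.val :=
  lift_mk_zero _ _ x

theorem ofSharpAdd_nonneg {x : Sharp (Gam R)} (hx : 0 ≤ x) : 0 ≤ ofSharpAdd R x := by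
  obtain ⟨k, c, hk, rfl⟩ := Sharp.nonneg_iff.1 hx
  rw [ofSharpAdd_mk]
  exact add_nonneg (zsmul_nonneg LuRing.su_nonneg hk) c.nonneg

/-- For an additive map, monotonicity is nonnegativity on the positive cone. -/
theorem ofSharpAdd_mono : Monotone (ofSharpAdd R) := fun x y h => by
  rw [← sub_nonneg, ← _root_.map_sub]
  exact ofSharpAdd_nonneg (sub_nonneg.2 h)

/-- The product on pairs is the expansion of (mu + x)(nu + y), so both sides agree term by term. -/
theorem ofSharpAdd_mul (x y : Sharp (Gam R)) :
    ofSharpAdd R (x * y) = ofSharpAdd R x * ofSharpAdd R y := by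
  induction x using Sharp.ind with | h m a =>
  induction y using Sharp.ind with | h n b =>
  simp only [mul_def, _root_.map_add, map_zsmul, ofSharpAdd_mk, zero_smul, zero_add, val_mul,
    val_topElt, mul_add, add_mul, smul_mul_assoc, mul_smul_comm, smul_add]
  rw [mul_comm b.val, mul_comm m n, mul_smul]
  abel

theorem ofSharpAdd_eq_zero_of_nonneg {x : Sharp (Gam R)} (hx : 0 ≤ x)
    (h : ofSharpAdd R x = 0) : x = 0 := by
  obtain ⟨k, c, hk, rfl⟩ := Sharp.nonneg_iff.1 hx
  rw [ofSharpAdd_mk] at h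
  have hsu : (0 : R) ≤ LuRing.su := LuRing.su_nonneg
  -- A vanishing sum of nonnegative terms forces ku = 0 and c = 0.
  obtain ⟨h1, h2⟩ := (add_eq_zero_iff_of_nonneg (zsmul_nonneg hsu hk) c.nonneg).1 h
  have hc : c = 0 := ext h2
  rcases hk.lt_or_eq with hk | rfl
  -- If k ≥ 1 then 0 ≤ u ≤ ku = 0, so the segment is trivial and (k, c) is zero although k is not.
  · refine eq_zero_of_trivial (ext ?_) _
    rw [val_topElt, val_zero]
    refine le_antisymm ?_ hsu
    rw [← h1]
    simpa using zsmul_le_zsmul_left hsu (show (1 : ℤ) ≤ k by omega)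
  · rw [hc, Sharp.zero_def]

theorem ofSharpAdd_injective : Function.Injective (ofSharpAdd R) := by
  refine (injective_iff_map_eq_zero _).2 fun x h => ?_
  rcases Sharp.le_total' 0 x with hx | hx
  · exact ofSharpAdd_eq_zero_of_nonneg hx h
  · rw [← neg_eq_zero]
    exact ofSharpAdd_eq_zero_of_nonneg (neg_nonneg.2 hx) (by rw [map_neg, h, neg_zero])

/-- Induction on the number of units needed: totality puts x either inside the segment or above `u`,
and in the second case x - u needs one unit fewer. The range is a subgroup, so `u` can be added
back. -/
theorem mem_range_of_le_nsmul (n : ℕ) {x : R} (hx : 0 ≤ x) (h : x ≤ n • LuRing.su) :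
    x ∈ (ofSharpAdd R).range := by
  have mem : ∀ y : R, 0 ≤ y → y ≤ LuRing.su → y ∈ (ofSharpAdd R).range := fun y h0 h1 =>
    ⟨mk 0 ⟨y, h0, h1⟩, ofSharpAdd_mk_zero _⟩
  induction n generalizing x with
  | zero =>
    rw [zero_smul] at h
    rw [le_antisymm h hx]
    exact zero_mem _
  | succ n ih =>
    rcases IsLuChain.total x LuRing.su with h1 | h1
    · exact mem x hx h1
    · rw [← sub_add_cancel x LuRing.su]
      refine add_mem (ih (sub_nonneg.2 h1) ?_) (mem _ LuRing.su_nonneg le_rfl)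
      rwa [sub_le_iff_le_add, ← succ_nsmul]

theorem ofSharpAdd_surjective : Function.Surjective (ofSharpAdd R) := fun x => by
  obtain ⟨n, hn⟩ := LuRing.exists_abs_le x
  rw [posPart_add_negPart] at hn
  rcases IsLuChain.total 0 x with hx | hx
  · exact mem_range_of_le_nsmul n hx ((le_abs_self x).trans hn)
  · have := mem_range_of_le_nsmul n (neg_nonneg.2 hx) ((neg_le_abs x).trans hn)
    exact AddMonoidHom.mem_range.1 (neg_mem_iff.1 this)

/-- The counit `(m, x) ↦ m u + x`, as a homomorphism of `l_u`-rings. -/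
noncomputable def ofSharp (R : Type v) [LuRing R] [IsSemiLow R] [IsLuChain R] :
    LuRingHom (Sharp (Gam R)) R where
  toFun := ofSharpAdd R
  map_add' := _root_.map_add _
  map_mul' := ofSharpAdd_mul
  -- On a totally ordered source a monotone map preserves binary suprema and infima.
  map_sup' := ofSharpAdd_mono.map_sup
  map_inf' := ofSharpAdd_mono.map_inf
  map_su' := by rw [Sharp.su_def, ofSharpAdd_mk_zero, val_topElt]

end Counit

/-! ### Naturality of the counit. -/

section Naturality

variable {R S : Type v} [LuRing R] [IsSemiLow R] [IsLuChain R] [LuRing S] [IsSemiLow S]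
  [IsLuChain S]

/-- Both composites are additive, and `hom_ext` reduces their equality to the classes (0, a), where
both give f(a). -/
theorem ofSharpAdd_mapFun (f : LuRingHom R S) (x : Sharp (Gam R)) :
    ofSharpAdd S (mapFun (map f) x) = f.toFun (ofSharpAdd R x) := by
  let F : R →+ S := AddMonoidHom.mk' f.toFun f.map_add'
  have h : (ofSharpAdd S).comp (mapAdd (map f)) = F.comp (ofSharpAdd R) :=
    hom_ext fun a => by
      rw [AddMonoidHom.comp_apply, AddMonoidHom.comp_apply, ← mapFun_eq, mapFun_mk,
        ofSharpAdd_mk_zero, ofSharpAdd_mk_zero]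
      rfl
  rw [mapFun_eq]
  exact DFunLike.congr_fun h x

end Naturality

end Gam

/-! ### The natural isomorphisms and the equivalence. -/

/-- The natural transformation `i : 𝟭 ⟶ Γ ∘ (-)^♯`. -/
noncomputable def unitTrans : 𝟭 CPMVf.{v} ⟶ sharpFunctor.{v} ⋙ gammaFunctor.{v} where
  app A := Sharp.toGam A
  naturality _ _ _ := PMVfHom.ext rfl

/-- The natural transformation `υ : (-)^♯ ∘ Γ ⟶ 𝟭`. -/
noncomputable def counitTrans : gammaFunctor.{v} ⋙ sharpFunctor.{v} ⟶ 𝟭 CLRu.{v} where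
  app R := Gam.ofSharp R
  naturality _ _ f := LuRingHom.ext (funext fun x => Gam.ofSharpAdd_mapFun f x)

theorem mainTheorem2 :
    ∃ (i : 𝟭 CPMVf.{v} ≅ sharpFunctor.{v} ⋙ gammaFunctor.{v})
      (υ : gammaFunctor.{v} ⋙ sharpFunctor.{v} ≅ 𝟭 CLRu.{v}),
      (∀ (A : CPMVf.{v}) (a : A),
        Gam.val (R := Sharp A) (i.hom.app A a) = Sharp.mk 0 a) ∧
      (∀ (R : CLRu.{v}) (m : ℤ) (x : Gam R),
        υ.hom.app R (Sharp.mk m x) = m • (LuRing.su : R) + x.val) ∧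
      sharpFunctor.{v}.IsEquivalence ∧ gammaFunctor.{v}.IsEquivalence := by
  have hi : ∀ A, IsIso (unitTrans.{v}.app A) := fun A =>
    CPMVf.isIso_of_bijective _ Sharp.toGam_bijective
  have hυ : ∀ R, IsIso (counitTrans.{v}.app R) := fun R =>
    CLRu.isIso_of_bijective _ ⟨Gam.ofSharpAdd_injective, Gam.ofSharpAdd_surjective⟩
  have := NatIso.isIso_of_isIso_app unitTrans.{v}
  have := NatIso.isIso_of_isIso_app counitTrans.{v}
  -- `Equivalence.mk` needs no triangle identities: it adjusts one of the isomorphisms inside `E`.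
  -- The `i` and `υ` returned below are the original ones, so the explicit formulas hold for them.
  let E : CPMVf.{v} ≌ CLRu.{v} :=
    CategoryTheory.Equivalence.mk sharpFunctor gammaFunctor (asIso unitTrans) (asIso counitTrans)
  exact ⟨asIso unitTrans, asIso counitTrans, fun _ _ => rfl,
    fun _ m x => Gam.ofSharpAdd_mk m x, E.isEquivalence_functor, E.isEquivalence_inverse⟩
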